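/- Let $\mathbb{F}_q$ be a finite field of characteristic $2$, let $k$ be a positive integer, and let $I_1,I_2,I_3,I_4\subseteq[n]$. For a nonempty $J\subseteq[4]$ put $\mathrm{wt}(I_J)=\sum_{j\in J}|I_j|-\left|\bigcup_{j\in J}I_j\right|$. Assume that 1. $\mathrm{wt}(I_J)\le(|J|-1)k$ for every nonempty $J\subseteq[4]$, and 2. $\mathrm{wt}(I_{[4]})=3k$. For $S\subseteq[n]$ let $V_k(S)$ be the $|S|\times k$ matrix, in variables $x_1,\dots,x_n$, with rows $(1,x_a,\dots,x_a^{k-1})$ for $a\in S$; let $\mathcal{I}_k$ be the identity matrix of order $k$; and let $\mathcal{B}_4$ be the $3\times 6$ binary matrix whose columns are labelled by the edges $\{1,2\},\{1,3\},\{2,3\},\{1,4\},\{2,4\},\{3,4\}$ of the complete graph $K_4$, and whose rows are the indicator vectors of the edge sets of the three triangles on the vertex sets $\{i,j,4\}$, $1\le i<j\le 3$. Let $M_{k,(I_1,I_2,I_3,I_4)}$ be the $4$-wise intersection matrix $$M_{k,(I_1,I_2,I_3,I_4)}=\begin{pmatrix}\mathcal{B}_4\otimes\mathcal{I}_k\\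 \mathrm{diag}\big(V_k(I_i\cap I_j):1\le i<j\le 4\big)\end{pmatrix},$$ where the blocks of the block diagonal matrix are ordered in the same way as the columns of $\mathcal{B}_4$; it is of order $\big(3k+\sum_{1\le i<j\le 4}|I_i\cap I_j|\big)\times 6k$ and has entries in $\mathbb{F}_q[x_1,\dots,x_n]$. Then $M_{k,(I_1,I_2,I_3,I_4)}$ is nonsingular, i.e. it has a $6k\times 6k$ submatrix whose determinant is a nonzero polynomial in $\mathbb{F}_q[x_1,\dots,x_n]$. -/

import Mathlib

open scoped Kronecker

/-- The edges of the complete graph on the vertex set `Fin t`; the edge `{i, j}` with `i < j` is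
represented by the pair `(i, j)`. -/
abbrev Edge (t : ℕ) : Type := {e : Fin t × Fin t // e.1 < e.2}

/-- The weight `wt(I_J) = ∑_{j ∈ J} |I_j| - |⋃_{j ∈ J} I_j|` of the sets `I_j`, `j ∈ J`. -/
def wt {n t : ℕ} (I : Fin t → Finset (Fin n)) (J : Finset (Fin t)) : ℤ :=
  (∑ j ∈ J, ((I j).card : ℤ)) - ((J.biUnion I).card : ℤ)

/-- The triangle basis `B_{m+1}` of the cycle space of the complete graph on `Fin (m + 1)`.
The row of `(i, j)`, `i < j < m`, is the indicator vector of the edge set of the triangle on the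
vertices `i`, `j` and the last vertex `m`. -/
def triangleMatrix (m : ℕ) (R : Type*) [Zero R] [One R] : Matrix (Edge m) (Edge (m + 1)) R :=
  Matrix.of fun d e =>
    if e.1.1 ∈ ({d.1.1.castSucc, d.1.2.castSucc, Fin.last m} : Finset (Fin (m + 1))) ∧
        e.1.2 ∈ ({d.1.1.castSucc, d.1.2.castSucc, Fin.last m} : Finset (Fin (m + 1)))
    then 1 else 0

/-- The Vandermonde matrix `V_k(S)` in the variables `x_a`, `a ∈ S`: the row of `a` is
`(1, x_a, …, x_a ^ (k - 1))`. -/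
noncomputable def variableVandermonde (F : Type*) [CommSemiring F] {n : ℕ} (k : ℕ)
    (S : Finset (Fin n)) : Matrix S (Fin k) (MvPolynomial (Fin n) F) :=
  Matrix.of fun a l => MvPolynomial.X (a : Fin n) ^ (l : ℕ)

/-- The block diagonal matrix with the blocks `V_k(I_i ∩ I_j)`, one for each edge `{i, j}`. -/
noncomputable def vandermondeDiag (F : Type*) [CommSemiring F] {n t : ℕ} (k : ℕ)
    (I : Fin t → Finset (Fin n)) :
    Matrix (Σ e : Edge t, (I e.1.1 ∩ I e.1.2 : Finset (Fin n))) (Edge t × Fin k)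
      (MvPolynomial (Fin n) F) :=
  Matrix.of fun r c =>
    if r.1 = c.1 then variableVandermonde F k (I r.1.1.1 ∩ I r.1.1.2) r.2 c.2 else 0

/-- The row index set of the `(m + 1)`-wise intersection matrix. -/
abbrev IntersectionRow {n m : ℕ} (k : ℕ) (I : Fin (m + 1) → Finset (Fin n)) : Type :=
  (Edge m × Fin k) ⊕ (Σ e : Edge (m + 1), (I e.1.1 ∩ I e.1.2 : Finset (Fin n)))

/-- The `t`-wise intersection matrix `M_{k,(I_1,…,I_t)}` with `t = m + 1`: the matrix
`B_t ⊗ 1_k` stacked on top of the block diagonal matrix `diag(V_k(I_i ∩ I_j))`. -/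
noncomputable def intersectionMatrix (F : Type*) [CommSemiring F] {n m : ℕ} (k : ℕ)
    (I : Fin (m + 1) → Finset (Fin n)) :
    Matrix (IntersectionRow k I) (Edge (m + 1) × Fin k) (MvPolynomial (Fin n) F) :=
  Matrix.fromRows
    (triangleMatrix m (MvPolynomial (Fin n) F) ⊗ₖ
      (1 : Matrix (Fin k) (Fin k) (MvPolynomial (Fin n) F)))
    (vandermondeDiag F k I)

/-! Keep all `3k` triangle rows and, for each element `a` with `m` the last index such that `a ∈
I_m`, only the rows of `a` in the blocks of edges `{i, m}`. These edges form a star, so `a`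
contributes one row less than the number of sets containing it. In total that gives `wt(I_{[4]}) =
3k` rows, and the selected matrix is square.

Let `v` be in its left kernel, with entries `y_e(a)` on the Vandermonde rows, and put `c_i(a) = ∑_{e
∋ i} y_e(a)`. Every vertex has even degree in a triangle, so in characteristic 2 adding the column
equations over the edges at `i` removes the triangle rows: `c_i` is supported on `I_i` and has
vanishing moments of order `< k`. Each edge has two ends, so `∑_i c_i = 0`. Thus the `c_i` are
dependent words, with prescribed supports, of the dual of a generic Reed-Solomon code. The weight
inequalities are exactly the Hall condition of the GM-MDS theorem, so all `c_i` vanish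
(`eq_zero_of_supported_of_moments`). At a leaf `i` of the star of `a` the sum `c_i(a)` has the
single term `y_{im}(a)`, so `y = 0`; the triangle rows are independent, so `v = 0`.

GM-MDS itself (`zeroPatternIndependent_of_condition`) is proved for polynomials with prescribed
roots, allowing one multiple root `x_s`, by induction on the number of patterns plus the number of
simple points plus the degree bound. Tight subfamilies are contracted to their common roots; without
tight subfamilies there is slack to specialize some `x_j` to `x_s`. -/

open Polynomial in
/-- The monic polynomial with a simple root at `x_a` for every `a ∈ Z` and a root of multiplicity
`r` at `x_s`. -/
noncomputable def rootPoly (F : Type*) [Field F] {σ : Type*} (s : σ) (Z : Finset σ) (r : ℕ) :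
    (MvPolynomial σ F)[X] :=
  (X - C (MvPolynomial.X s)) ^ r * ∏ a ∈ Z, (X - C (MvPolynomial.X a))

/-- The Hall-type condition of the GM-MDS theorem, for the zero patterns consisting of simple zeros
on `Z i` and a zero of order `r i` at one further point. -/
def ZeroPatternCondition {ι σ : Type*} (J : Finset ι) (Z : ι → Finset σ) (r : ι → ℕ) (k : ℕ) :
    Prop :=
  ∀ I ⊆ J, I.Nonempty → ∀ (W : Finset σ) (ρ : ℕ), (∀ i ∈ I, W ⊆ Z i) → (∀ i ∈ I, ρ ≤ r i) →
    ∑ i ∈ I, ((k : ℤ) - (Z i).card - r i) + W.card + ρ ≤ k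

/-! ### Independence of polynomials with prescribed roots: reduction steps. -/

section RootPoly

open Polynomial

variable {F : Type*} [Field F] {σ : Type*}

theorem rootPoly_monic (s : σ) (Z : Finset σ) (r : ℕ) : (rootPoly F s Z r).Monic :=
  ((monic_X_sub_C _).pow r).mul (monic_prod_of_monic _ _ fun _ _ => monic_X_sub_C _)

theorem rootPoly_natDegree (s : σ) (Z : Finset σ) (r : ℕ) :
    (rootPoly F s Z r).natDegree = Z.card + r := by
  rw [rootPoly, Monic.natDegree_mul ((monic_X_sub_C _).pow r)
    (monic_prod_of_monic _ _ fun _ _ => monic_X_sub_C _), (monic_X_sub_C _).natDegree_pow,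
    natDegree_prod_of_monic _ _ fun _ _ => monic_X_sub_C _]
  simp [add_comm]

theorem rootPoly_succ (s : σ) (Z : Finset σ) (r : ℕ) :
    rootPoly F s Z (r + 1) = (X - C (MvPolynomial.X s)) * rootPoly F s Z r := by
  rw [rootPoly, rootPoly, pow_succ]; ring

theorem rootPoly_erase [DecidableEq σ] (s : σ) {Z : Finset σ} {j : σ} (hj : j ∈ Z) (r : ℕ) :
    rootPoly F s Z r = (X - C (MvPolynomial.X j)) * rootPoly F s (Z.erase j) r := by
  rw [rootPoly, rootPoly, ← Finset.mul_prod_erase Z _ hj]; ring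

theorem rootPoly_dvd (s : σ) {W Z : Finset σ} {ρ r : ℕ} (hW : W ⊆ Z) (hρ : ρ ≤ r) :
    rootPoly F s W ρ ∣ rootPoly F s Z r :=
  mul_dvd_mul (pow_dvd_pow _ hρ) (Finset.prod_dvd_prod_of_subset _ _ _ hW)

theorem eq_zero_of_degree_rootPoly_mul_lt {s : σ} {Z : Finset σ} {r k : ℕ}
    (hk : k ≤ Z.card + r) {h : (MvPolynomial σ F)[X]}
    (hh : (rootPoly F s Z r * h).degree < k) : h = 0 := by
  by_contra h0
  rw [(rootPoly_monic s Z r).degree_mul_comm, (rootPoly_monic s Z r).degree_mul,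
    degree_eq_natDegree h0, degree_eq_natDegree (rootPoly_monic s Z r).ne_zero,
    rootPoly_natDegree] at hh
  norm_cast at hh
  omega

theorem degree_lt_of_X_sub_C_mul {R : Type*} [CommRing R] [IsDomain R] {a : R} {q : R[X]} {k : ℕ}
    (h : ((X - C a) * q).degree < ((k + 1 : ℕ) : WithBot ℕ)) : q.degree < k := by
  by_cases h0 : q = 0
  · simp [h0]
  rw [degree_mul, degree_X_sub_C, degree_eq_natDegree h0] at h
  rw [degree_eq_natDegree h0]
  norm_cast at h ⊢
  omega

variable [DecidableEq σ]

/-- The specialization of the variable `x_j` to `x_s`. -/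
noncomputable def mergeVar (F : Type*) [Field F] (j s : σ) :
    MvPolynomial σ F →ₐ[F] MvPolynomial σ F :=
  MvPolynomial.aeval (Function.update MvPolynomial.X j (MvPolynomial.X s))

theorem mergeVar_X_self (j s : σ) : mergeVar F j s (MvPolynomial.X j) = MvPolynomial.X s := by
  simp [mergeVar]

theorem mergeVar_X_of_ne {j a : σ} (s : σ) (h : a ≠ j) :
    mergeVar F j s (MvPolynomial.X a) = MvPolynomial.X a := by
  simp [mergeVar, h]

/-- Modulo `x_j - x_s` the specialization is the identity, as is seen on the variables. -/
theorem dvd_of_mergeVar_eq_zero {j s : σ} {p : MvPolynomial σ F} (hp : mergeVar F j s p = 0) :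
    (MvPolynomial.X j - MvPolynomial.X s) ∣ p := by
  set π : MvPolynomial σ F := MvPolynomial.X j - MvPolynomial.X s
  have key : (Ideal.Quotient.mkₐ F (Ideal.span {π})).comp (mergeVar F j s) =
      Ideal.Quotient.mkₐ F (Ideal.span {π}) := by
    ext a
    by_cases ha : a = j
    · subst ha
      simp only [AlgHom.comp_apply, mergeVar_X_self, Ideal.Quotient.mkₐ_eq_mk]
      rw [eq_comm, Ideal.Quotient.eq]
      exact Ideal.mem_span_singleton_self _
    · simp [mergeVar_X_of_ne s ha]
  have h := DFunLike.congr_fun key p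
  rw [AlgHom.comp_apply, hp, map_zero, eq_comm, Ideal.Quotient.mkₐ_eq_mk,
    Ideal.Quotient.eq_zero_iff_mem, Ideal.mem_span_singleton] at h
  exact h

theorem map_mergeVar_rootPoly {j s : σ} (hjs : j ≠ s) (Z : Finset σ) (r : ℕ) :
    (rootPoly F s Z r).map (mergeVar F j s).toRingHom =
      rootPoly F s (Z.erase j) (r + if j ∈ Z then 1 else 0) := by
  have hZ : ∀ Z : Finset σ, j ∉ Z → ∀ r, (rootPoly F s Z r).map (mergeVar F j s).toRingHom =
      rootPoly F s Z r := by
    intro Z hj r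
    simp only [rootPoly, Polynomial.map_mul, Polynomial.map_pow, Polynomial.map_prod,
      Polynomial.map_sub, map_X, map_C]
    congr 1
    · congr 3
      exact mergeVar_X_of_ne s hjs.symm
    · refine Finset.prod_congr rfl fun a ha => ?_
      congr 2
      exact mergeVar_X_of_ne s (ne_of_mem_of_not_mem ha hj)
  by_cases hj : j ∈ Z
  · rw [rootPoly_erase s hj, Polynomial.map_mul, hZ _ (Finset.notMem_erase j Z), if_pos hj,
      rootPoly_succ]
    congr 1
    simp only [Polynomial.map_sub, map_X, map_C]
    congr 2
    exact mergeVar_X_self j s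
  · rw [hZ Z hj, if_neg hj, Finset.erase_eq_of_notMem hj, add_zero]

/-- Only the zero combination of polynomials of degree `< k` with the prescribed zero patterns
vanishes. -/
def ZeroPatternIndependent (F : Type*) [Field F] {ι : Type*} (s : σ) (J : Finset ι)
    (Z : ι → Finset σ) (r : ι → ℕ) (k : ℕ) : Prop :=
  ∀ h : ι → (MvPolynomial σ F)[X], (∀ i ∈ J, (rootPoly F s (Z i) (r i) * h i).degree < k) →
    ∑ i ∈ J, rootPoly F s (Z i) (r i) * h i = 0 → ∀ i ∈ J, h i = 0

variable {ι : Type*}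

/-- Independence of the zero patterns may be tested after the specialization `x_j = x_s`. -/
theorem ZeroPatternIndependent.of_merge {j s : σ} (hjs : j ≠ s) {J : Finset ι}
    {Z : ι → Finset σ} {r : ι → ℕ} {k : ℕ}
    (H : ZeroPatternIndependent F s J (fun i => (Z i).erase j)
      (fun i => r i + if j ∈ Z i then 1 else 0) k) :
    ZeroPatternIndependent F s J Z r k := by
  set π : MvPolynomial σ F := MvPolynomial.X j - MvPolynomial.X s with hπ
  have hπ0 : π ≠ 0 := sub_ne_zero.2 fun h => hjs (MvPolynomial.X_injective h)
  have hπu : ¬ IsUnit (C π) := fun hu => by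
    have h1 := (isUnit_C.1 hu).map (mergeVar F j s)
    rw [hπ, map_sub, mergeVar_X_self, mergeVar_X_of_ne s hjs.symm, sub_self] at h1
    exact not_isUnit_zero h1
  -- A relation specializes to a relation between the merged patterns, hence to the trivial one.
  have step : ∀ h : ι → (MvPolynomial σ F)[X],
      (∀ i ∈ J, (rootPoly F s (Z i) (r i) * h i).degree < k) →
      ∑ i ∈ J, rootPoly F s (Z i) (r i) * h i = 0 → ∀ i ∈ J, C π ∣ h i := by
    intro h hd hs i hi
    have h1 := H (fun i => (h i).map (mergeVar F j s).toRingHom) ?_ ?_ i hi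
    · rw [C_dvd_iff_dvd_coeff]
      intro m
      apply dvd_of_mergeVar_eq_zero
      have := congrArg (fun q => q.coeff m) h1
      simpa using this
    · intro i hi
      rw [← map_mergeVar_rootPoly hjs, ← Polynomial.map_mul]
      exact degree_map_le.trans_lt (hd i hi)
    · have := congrArg (Polynomial.map (mergeVar F j s).toRingHom) hs
      rw [Polynomial.map_sum, Polynomial.map_zero] at this
      rw [← this]
      refine Finset.sum_congr rfl fun i _ => ?_
      rw [Polynomial.map_mul, map_mergeVar_rootPoly hjs]
  -- Dividing a relation by `π` leaves a relation of the same kind, so every power of `π` divides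
  -- it; a nonzero polynomial has finite multiplicity.
  have iter : ∀ m : ℕ, ∀ h : ι → (MvPolynomial σ F)[X],
      (∀ i ∈ J, (rootPoly F s (Z i) (r i) * h i).degree < k) →
      ∑ i ∈ J, rootPoly F s (Z i) (r i) * h i = 0 → ∀ i ∈ J, C π ^ m ∣ h i := by
    intro m
    induction m with
    | zero => intro h _ _ i _; simp
    | succ m ih =>
      intro h hd hs i hi
      have h1 := step h hd hs
      choose! q hq using h1
      have h2 := ih q ?_ ?_ i hi
      · rw [hq i hi, pow_succ']
        exact mul_dvd_mul_left _ h2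
      · intro i hi
        have := hd i hi
        rwa [hq i hi, mul_left_comm, degree_C_mul hπ0] at this
      · have h3 : C π * ∑ i ∈ J, rootPoly F s (Z i) (r i) * q i = 0 := by
          rw [← hs, Finset.mul_sum]
          refine Finset.sum_congr rfl fun i hi => ?_
          rw [hq i hi]; ring
        exact (mul_eq_zero.1 h3).resolve_left (by simpa using hπ0)
  intro h hd hs i hi
  by_contra h0
  obtain ⟨m, hm⟩ := FiniteMultiplicity.of_not_isUnit hπu h0
  exact hm (iter _ h hd hs i hi)

omit [DecidableEq σ] in
/-- Independence of the zero patterns follows from independence within a subfamily `I` and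
independence after replacing `I` by a common part of its patterns. -/
theorem ZeroPatternIndependent.of_contract [DecidableEq ι] {s : σ} {J I : Finset ι}
    {Z : ι → Finset σ} {r : ι → ℕ} {k : ℕ} (hIJ : I ⊆ J) {i₀ : ι} (hi₀ : i₀ ∈ I)
    {W : Finset σ} {ρ : ℕ} (hW : ∀ i ∈ I, W ⊆ Z i) (hρ : ∀ i ∈ I, ρ ≤ r i)
    (HI : ZeroPatternIndependent F s I Z r k)
    (HJ : ZeroPatternIndependent F s (insert i₀ (J \ I)) (Function.update Z i₀ W)
      (Function.update r i₀ ρ) k) :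
    ZeroPatternIndependent F s J Z r k := by
  intro h hd hs
  have h1 : ∀ i ∈ I, ∃ q, rootPoly F s (Z i) (r i) = rootPoly F s W ρ * q := fun i hi =>
    rootPoly_dvd s (hW i hi) (hρ i hi)
  choose! q hq using h1
  have hsum : rootPoly F s W ρ * ∑ i ∈ I, q i * h i =
      ∑ i ∈ I, rootPoly F s (Z i) (r i) * h i := by
    rw [Finset.mul_sum]
    refine Finset.sum_congr rfl fun i hi => ?_
    rw [hq i hi]; ring
  have hne : ∀ i ∈ J \ I, i ≠ i₀ := fun i hi h => (Finset.mem_sdiff.1 hi).2 (h ▸ hi₀)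
  -- The terms of `I` add up to one multiple of the common part, which becomes the term of `i₀`.
  have key := HJ (Function.update h i₀ (∑ i ∈ I, q i * h i)) ?_ ?_
  · have hI : ∑ i ∈ I, rootPoly F s (Z i) (r i) * h i = 0 := by
      have := key i₀ (Finset.mem_insert_self _ _)
      rw [Function.update_self] at this
      rw [← hsum, this, mul_zero]
    intro i hi
    by_cases hiI : i ∈ I
    · exact HI h (fun i hi => hd i (hIJ hi)) hI i hiI
    · have hm : i ∈ J \ I := Finset.mem_sdiff.2 ⟨hi, hiI⟩
      have := key i (Finset.mem_insert_of_mem hm)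
      rwa [Function.update_of_ne (hne i hm)] at this
  · intro i hi
    rcases Finset.mem_insert.1 hi with rfl | hi
    · simp only [Function.update_self]
      rw [hsum, ← mem_degreeLT]
      exact Submodule.sum_mem _ fun i hi => mem_degreeLT.2 (hd i (hIJ hi))
    · simp only [Function.update_of_ne (hne i hi)]
      exact hd i (Finset.mem_sdiff.1 hi).1
  · rw [Finset.sum_insert (fun hm : i₀ ∈ J \ I => hne i₀ hm rfl)]
    simp only [Function.update_self]
    rw [hsum, ← hs, ← Finset.sum_sdiff hIJ, add_comm]
    congr 1
    refine Finset.sum_congr rfl fun i hi => ?_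
    simp only [Function.update_of_ne (hne i hi)]

omit [DecidableEq σ] in
/-- A common linear factor can be split off. -/
theorem ZeroPatternIndependent.of_factor {s : σ} {J : Finset ι} {Z Z' : ι → Finset σ}
    {r r' : ι → ℕ} {k : ℕ} (a : MvPolynomial σ F)
    (hp : ∀ i ∈ J, rootPoly F s (Z i) (r i) = (X - C a) * rootPoly F s (Z' i) (r' i))
    (H : ZeroPatternIndependent F s J Z' r' k) : ZeroPatternIndependent F s J Z r (k + 1) := by
  intro h hd hs
  apply H h
  · intro i hi
    have := hd i hi
    rw [hp i hi, mul_assoc] at this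
    exact degree_lt_of_X_sub_C_mul this
  · have h3 : (X - C a) * ∑ i ∈ J, rootPoly F s (Z' i) (r' i) * h i = 0 := by
      rw [← hs, Finset.mul_sum]
      refine Finset.sum_congr rfl fun i hi => ?_
      rw [hp i hi, mul_assoc]
    exact (mul_eq_zero.1 h3).resolve_left (X_sub_C_ne_zero a)

omit [DecidableEq σ] in
/-- If all patterns but that of `i₁` vanish at `x_s`, one may pass to the quotients by `X - x_s`,
keeping the pattern of `i₁`. -/
theorem ZeroPatternIndependent.of_unique [DecidableEq ι] {s : σ} {J : Finset ι}
    {Z : ι → Finset σ} {r : ι → ℕ} {k : ℕ} {i₁ : ι} (hi₁ : i₁ ∈ J) (hr₁ : r i₁ = 0)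
    (hs₁ : s ∉ Z i₁) (hr : ∀ i ∈ J, i ≠ i₁ → 1 ≤ r i)
    (H : ZeroPatternIndependent F s J Z (fun i => r i - 1) k) :
    ZeroPatternIndependent F s J Z r (k + 1) := by
  intro h hd hs
  have hp : ∀ i ∈ J, i ≠ i₁ → rootPoly F s (Z i) (r i) =
      (X - C (MvPolynomial.X s)) * rootPoly F s (Z i) (r i - 1) := fun i hi hne => by
    obtain ⟨m, hm⟩ := Nat.exists_eq_add_of_le' (hr i hi hne)
    rw [hm, rootPoly_succ, Nat.add_sub_cancel]
  -- At `x_s` every other term vanishes, while the pattern of `i₁` does not.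
  have hev : (h i₁).eval (MvPolynomial.X s) = 0 := by
    have h1 := congrArg (eval (MvPolynomial.X s)) hs
    rw [eval_finsetSum, Finset.sum_eq_single_of_mem i₁ hi₁ (fun i hi hne => by
      rw [hp i hi hne]; simp), eval_mul, eval_zero] at h1
    refine (mul_eq_zero.1 h1).resolve_left ?_
    rw [rootPoly, hr₁, pow_zero, one_mul, eval_prod]
    refine Finset.prod_ne_zero_iff.2 fun a ha => ?_
    rw [eval_sub, eval_X, eval_C, sub_ne_zero]
    intro h2
    exact hs₁ (MvPolynomial.X_injective h2 ▸ ha)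
  obtain ⟨q, hq⟩ := dvd_iff_isRoot.2 hev
  have hterm : ∀ i ∈ J, rootPoly F s (Z i) (r i) * h i = (X - C (MvPolynomial.X s)) *
      (rootPoly F s (Z i) (r i - 1) * Function.update h i₁ q i) := by
    intro i hi
    by_cases hne : i = i₁
    · subst hne
      rw [Function.update_self, hq, hr₁]; ring
    · rw [Function.update_of_ne hne, hp i hi hne, mul_assoc]
  have key := H (Function.update h i₁ q) ?_ ?_
  · intro i hi
    have := key i hi
    by_cases hne : i = i₁
    · subst hne
      rw [Function.update_self] at this
      rw [hq, this, mul_zero]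
    · rwa [Function.update_of_ne hne] at this
  · intro i hi
    have := hd i hi
    rw [hterm i hi] at this
    exact degree_lt_of_X_sub_C_mul this
  · rw [Finset.sum_congr rfl hterm, ← Finset.mul_sum] at hs
    exact (mul_eq_zero.1 hs).resolve_left (X_sub_C_ne_zero _)

end RootPoly

/-! ### The Hall-type condition and the GM-MDS induction. -/

section GMMDS

variable {ι σ : Type*}

theorem ZeroPatternCondition.mono {J J' : Finset ι} {Z : ι → Finset σ} {r : ι → ℕ} {k : ℕ}
    (H : ZeroPatternCondition J Z r k) (h : J' ⊆ J) : ZeroPatternCondition J' Z r k :=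
  fun I hI => H I (hI.trans h)

variable [DecidableEq ι]

/-- Tightness lets `I` replace the contracted member: the inequality for a subfamily containing `i₀`
follows from the old one for its other members together with all of `I`. -/
theorem ZeroPatternCondition.contract {J I : Finset ι} {Z : ι → Finset σ} {r : ι → ℕ} {k : ℕ}
    (H : ZeroPatternCondition J Z r k) (hIJ : I ⊆ J) {i₀ : ι} (hi₀ : i₀ ∈ I)
    {W : Finset σ} {ρ : ℕ} (hW : ∀ i ∈ I, W ⊆ Z i) (hρ : ∀ i ∈ I, ρ ≤ r i)
    (htight : (k : ℤ) ≤ ∑ i ∈ I, ((k : ℤ) - (Z i).card - r i) + W.card + ρ) :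
    ZeroPatternCondition (insert i₀ (J \ I)) (Function.update Z i₀ W)
      (Function.update r i₀ ρ) k := by
  have hne : ∀ i ∈ J \ I, i ≠ i₀ := fun i hi h => (Finset.mem_sdiff.1 hi).2 (h ▸ hi₀)
  intro T hT hTne V τ hV hτ
  have hsub : T.erase i₀ ⊆ J \ I := fun i hi =>
    (Finset.mem_insert.1 (hT (Finset.mem_of_mem_erase hi))).resolve_left (Finset.ne_of_mem_erase hi)
  have hcongr : ∑ i ∈ T.erase i₀, ((k : ℤ) - (Function.update Z i₀ W i).card -
      (Function.update r i₀ ρ i : ℕ)) = ∑ i ∈ T.erase i₀, ((k : ℤ) - (Z i).card - r i) := by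
    refine Finset.sum_congr rfl fun i hi => ?_
    rw [Function.update_of_ne (Finset.ne_of_mem_erase hi),
      Function.update_of_ne (Finset.ne_of_mem_erase hi)]
  have hV' : ∀ i ∈ T.erase i₀, V ⊆ Z i := fun i hi => by
    have := hV i (Finset.mem_of_mem_erase hi)
    rwa [Function.update_of_ne (Finset.ne_of_mem_erase hi)] at this
  have hτ' : ∀ i ∈ T.erase i₀, τ ≤ r i := fun i hi => by
    have := hτ i (Finset.mem_of_mem_erase hi)
    rwa [Function.update_of_ne (Finset.ne_of_mem_erase hi)] at this
  by_cases hT0 : i₀ ∈ T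
  · have hVW := hV i₀ hT0
    have hτρ := hτ i₀ hT0
    rw [Function.update_self] at hVW hτρ
    have hdis : Disjoint (T.erase i₀) I := Finset.disjoint_of_subset_left hsub
      Finset.sdiff_disjoint
    have h1 := H (T.erase i₀ ∪ I) (Finset.union_subset (hsub.trans Finset.sdiff_subset) hIJ)
      ⟨i₀, Finset.mem_union_right _ hi₀⟩ V τ
      (fun i hi => (Finset.mem_union.1 hi).elim (hV' i) fun hi => hVW.trans (hW i hi))
      (fun i hi => (Finset.mem_union.1 hi).elim (hτ' i) fun hi => hτρ.trans (hρ i hi))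
    rw [Finset.sum_union hdis] at h1
    rw [← Finset.add_sum_erase T _ hT0, hcongr, Function.update_self, Function.update_self]
    linarith
  · rw [Finset.erase_eq_of_notMem hT0] at hsub hcongr hV' hτ'
    rw [hcongr]
    exact H T (hsub.trans Finset.sdiff_subset) hTne V τ hV' hτ'

variable [DecidableEq σ]

/-- The GM-MDS theorem for zero patterns with one multiple point. -/
theorem zeroPatternIndependent_of_condition (F : Type*) [Field F] (s : σ) (N : ℕ) :
    ∀ (J : Finset ι) (S : Finset σ) (Z : ι → Finset σ) (r : ι → ℕ) (k : ℕ),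
      J.card + S.card + k ≤ N → (∀ i ∈ J, Z i ⊆ S) → s ∉ S → ZeroPatternCondition J Z r k →
      ZeroPatternIndependent F s J Z r k := by
  induction N with
  | zero =>
    intro J S Z r k hN _ _ _ h _ _ i hi
    have : J = ∅ := Finset.card_eq_zero.1 (by omega)
    simp [this] at hi
  | succ N ih =>
    intro J S Z r k hN hZS hs H
    -- A pattern with at least `k` roots admits only the zero multiple and can be dropped.
    by_cases hbig : ∃ i ∈ J, k ≤ (Z i).card + r i
    · obtain ⟨i, hi, hik⟩ := hbig
      intro h hd hsum
      have h0 := eq_zero_of_degree_rootPoly_mul_lt hik (hd i hi)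
      have hc := Finset.card_erase_add_one hi
      have := ih (J.erase i) S Z r k (by omega) (fun l hl => hZS l (Finset.mem_of_mem_erase hl)) hs
        (H.mono (Finset.erase_subset _ _)) h (fun l hl => hd l (Finset.mem_of_mem_erase hl))
        (by rw [← hsum, ← Finset.add_sum_erase J _ hi, h0, mul_zero, zero_add])
      intro l hl
      by_cases hli : l = i
      · rw [hli, h0]
      · exact this l (Finset.mem_erase.2 ⟨hli, hl⟩)
    push Not at hbig
    rcases J.eq_empty_or_nonempty with rfl | hJ
    · intro h _ _ i hi
      simp at hi
    obtain ⟨k, rfl⟩ : ∃ k', k = k' + 1 := by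
      obtain ⟨i, hi⟩ := hJ
      exact Nat.exists_eq_succ_of_ne_zero (by have := hbig i hi; omega)
    by_cases hcom : ∃ j, ∀ i ∈ J, j ∈ Z i
    · obtain ⟨j, hj⟩ := hcom
      refine ZeroPatternIndependent.of_factor (MvPolynomial.X j)
        (fun i hi => rootPoly_erase s (hj i hi) (r i))
        (ih J S (fun i => (Z i).erase j) r k (by omega)
          (fun i hi => (Finset.erase_subset _ _).trans (hZS i hi)) hs ?_)
      intro I hI hIne W ρ hW hρ
      beta_reduce at hW hρ ⊢
      have hjW : j ∉ W := fun h => by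
        obtain ⟨i, hi⟩ := hIne
        exact Finset.notMem_erase j _ (hW i hi h)
      have h1 := H I hI hIne (insert j W) ρ
        (fun i hi => Finset.insert_subset (hj i (hI hi)) ((hW i hi).trans (Finset.erase_subset _ _)))
        hρ
      rw [Finset.card_insert_of_notMem hjW] at h1
      have h2 : ∑ i ∈ I, ((k : ℤ) - ((Z i).erase j).card - r i) =
          ∑ i ∈ I, (((k + 1 : ℕ) : ℤ) - (Z i).card - r i) := by
        refine Finset.sum_congr rfl fun i hi => ?_
        have := Finset.card_erase_add_one (hj i (hI hi))
        push_cast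
        omega
      rw [h2]
      push_cast at h1 ⊢
      linarith
    by_cases hrpos : ∀ i ∈ J, 1 ≤ r i
    · refine ZeroPatternIndependent.of_factor (MvPolynomial.X s)
        (Z' := Z) (r' := fun i => r i - 1) (fun i hi => ?_)
        (ih J S Z _ k (by omega) hZS hs ?_)
      · rw [← rootPoly_succ, Nat.sub_add_cancel (hrpos i hi)]
      intro I hI hIne W ρ hW hρ
      beta_reduce at hW hρ ⊢
      have h1 := H I hI hIne W (ρ + 1) hW
        (fun i hi => by have := hρ i hi; have := hrpos i (hI hi); omega)
      have h2 : ∑ i ∈ I, ((k : ℤ) - (Z i).card - (r i - 1 : ℕ)) =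
          ∑ i ∈ I, (((k + 1 : ℕ) : ℤ) - (Z i).card - r i) := by
        refine Finset.sum_congr rfl fun i hi => ?_
        have := hrpos i (hI hi)
        push_cast [this]
        ring
      rw [h2]
      push_cast at h1 ⊢
      linarith
    -- The size bounds make both `I` and the contracted family smaller than `J`.
    by_cases htight : ∃ I ⊆ J, 2 ≤ I.card ∧ I.card < J.card ∧ ∃ (W : Finset σ) (ρ : ℕ),
        (∀ i ∈ I, W ⊆ Z i) ∧ (∀ i ∈ I, ρ ≤ r i) ∧
        ((k + 1 : ℕ) : ℤ) ≤ ∑ i ∈ I, (((k + 1 : ℕ) : ℤ) - (Z i).card - r i) + W.card + ρ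
    · obtain ⟨I, hI, hI2, hIJ, W, ρ, hW, hρ, ht⟩ := htight
      obtain ⟨i₀, hi₀⟩ : I.Nonempty := Finset.card_pos.1 (by omega)
      have hcard : (insert i₀ (J \ I)).card + I.card ≤ J.card + 1 := by
        have h1 := Finset.card_insert_le i₀ (J \ I)
        have h2 := Finset.card_sdiff_add_card_eq_card hI
        omega
      refine ZeroPatternIndependent.of_contract hI hi₀ hW hρ
        (ih I S Z r _ (by omega) (fun i hi => hZS i (hI hi)) hs (H.mono hI))
        (ih _ S _ _ _ (by omega) ?_ hs (H.contract hI hi₀ hW hρ ht))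
      intro i hi
      by_cases hne : i = i₀
      · subst hne
        rw [Function.update_self]
        exact (hW i hi₀).trans (hZS i (hI hi₀))
      · rw [Function.update_of_ne hne]
        exact hZS i (Finset.mem_sdiff.1 ((Finset.mem_insert.1 hi).resolve_left hne)).1
    push Not at htight
    -- Merging `x_j` into `x_s` keeps the degrees of the patterns and can raise a common
    -- multiplicity at `x_s` by at most one. The member `i₂` prevents this for the whole family, and
    -- strictness absorbs it for proper subfamilies.
    by_cases hmerge : ∃ j ∈ S, ∃ i ∈ J, j ∉ Z i ∧ r i = 0
    · obtain ⟨j, hjS, i₂, hi₂, hj₂, hr₂⟩ := hmerge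
      have hjs : j ≠ s := fun h => hs (h ▸ hjS)
      have hScard := Finset.card_erase_add_one hjS
      refine ZeroPatternIndependent.of_merge hjs (ih J (S.erase j) _ _ _ (by omega)
        (fun i hi => Finset.erase_subset_erase j (hZS i hi))
        (fun h => hs (Finset.mem_of_mem_erase h)) ?_)
      have hsz : ∀ i, (((Z i).erase j).card : ℤ) + ((r i + if j ∈ Z i then 1 else 0 : ℕ) : ℤ) =
          (Z i).card + r i := by
        intro i
        by_cases hj : j ∈ Z i
        · have := Finset.card_erase_add_one hj
          rw [if_pos hj]
          omega
        · rw [if_neg hj, Finset.erase_eq_of_notMem hj, add_zero]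
      intro I hI hIne W ρ hW hρ
      beta_reduce at hW hρ ⊢
      have h2 : ∑ i ∈ I, (((k + 1 : ℕ) : ℤ) - ((Z i).erase j).card -
          ((r i + if j ∈ Z i then 1 else 0 : ℕ) : ℤ)) =
          ∑ i ∈ I, (((k + 1 : ℕ) : ℤ) - (Z i).card - r i) := by
        refine Finset.sum_congr rfl fun i hi => ?_
        have := hsz i
        linarith
      rw [h2]
      have hWZ : ∀ i ∈ I, W ⊆ Z i := fun i hi => (hW i hi).trans (Finset.erase_subset _ _)
      by_cases hI1 : I.card = 1
      · obtain ⟨i, rfl⟩ := Finset.card_eq_one.1 hI1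
        have h3 := Finset.card_le_card (hW i (Finset.mem_singleton_self i))
        have h4 := hρ i (Finset.mem_singleton_self i)
        have h5 := hsz i
        rw [Finset.sum_singleton]
        omega
      by_cases hIJ : I = J
      · have hρ0 : ρ = 0 := by
          have := hρ i₂ (hIJ ▸ hi₂)
          rw [if_neg hj₂, hr₂] at this
          omega
        subst hρ0
        exact H I hI hIne W 0 hWZ fun _ _ => Nat.zero_le _
      · have hlt : I.card < J.card := Finset.card_lt_card (hI.ssubset_of_ne hIJ)
        have hpos := hIne.card_pos
        have h3 := htight I hI (by omega) hlt W (ρ - 1) hWZ (fun i hi => by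
          have := hρ i hi
          split_ifs at this <;> omega)
        omega
    push Not at hmerge hrpos
    obtain ⟨i₁, hi₁, hr₁⟩ := hrpos
    have hr₁ : r i₁ = 0 := by omega
    have hfull : ∀ i ∈ J, r i = 0 → Z i = S := fun i hi hr =>
      (hZS i hi).antisymm fun j hj => by
        by_contra hjZ
        exact hmerge j hj i hi hjZ hr
    -- Two members not vanishing at `x_s` would both have the pattern `S`; the condition for this
    -- pair then forces `k + 1 ≤ |S|`, against `hbig`.
    have huniq : ∀ i ∈ J, i ≠ i₁ → 1 ≤ r i := by
      intro i hi hne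
      by_contra hr
      have hr : r i = 0 := by omega
      have h1 := H {i, i₁} (Finset.insert_subset hi (Finset.singleton_subset_iff.2 hi₁)) (by simp)
        S 0 (by simp [hfull i hi hr, hfull i₁ hi₁ hr₁]) (by simp)
      rw [Finset.sum_pair hne, hfull i hi hr, hfull i₁ hi₁ hr₁, hr, hr₁] at h1
      have h2 := hbig i hi
      rw [hfull i hi hr] at h2
      omega
    refine ZeroPatternIndependent.of_unique hi₁ hr₁ (fun h => hs (hZS i₁ hi₁ h)) huniq
      (ih J S Z _ k (by omega) hZS hs ?_)
    intro I hI hIne W ρ hW hρ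
    beta_reduce at hW hρ ⊢
    have hterm : ∀ i ∈ I, i ≠ i₁ → (k : ℤ) - (Z i).card - (r i - 1 : ℕ) =
        ((k + 1 : ℕ) : ℤ) - (Z i).card - r i := fun i hi hne => by
      have := huniq i (hI hi) hne
      push_cast [this]
      ring
    -- If `i₁ ∈ I`, its term falls by one along with the bound, since `r i₁ - 1` truncates to `0`.
    -- Otherwise the common multiplicity at `x_s` was one larger before the division.
    by_cases hi : i₁ ∈ I
    · have hρ0 : ρ = 0 := by
        have := hρ i₁ hi
        omega
      subst hρ0
      have h1 := H I hI hIne W 0 hW (by simp)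
      rw [← Finset.add_sum_erase I _ hi] at h1 ⊢
      rw [Finset.sum_congr rfl fun i hi =>
        hterm i (Finset.mem_of_mem_erase hi) (Finset.ne_of_mem_erase hi)]
      simp only [hr₁] at h1 ⊢
      push_cast at h1 ⊢
      linarith
    · have hne : ∀ i ∈ I, i ≠ i₁ := fun i h => ne_of_mem_of_not_mem h hi
      have h1 := H I hI hIne W (ρ + 1) hW (fun i hi => by
        have := hρ i hi
        have := huniq i (hI hi) (hne i hi)
        omega)
      rw [Finset.sum_congr rfl fun i hi => hterm i hi (hne i hi)]
      push_cast at h1 ⊢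
      linarith

end GMMDS

/-! ### Dual Reed-Solomon words as polynomials with prescribed roots. -/

section DualCode

open Polynomial

/-- Comparing the full product with the product omitting `a` expresses coefficient `m` through
coefficient `m + 1`, at the cost of one more factor `x a` and a moment of order `l < k`. The bound
on `l - m` is preserved, and the descent counter `N` ends where `m` exceeds the degree. -/
theorem sum_mul_pow_mul_coeff_eq_zero {R σ : Type*} [CommRing R] [Fintype σ] [DecidableEq σ]
    (x c : σ → R) {k : ℕ} (hc : ∀ l < k, ∑ a, c a * x a ^ l = 0) (N : ℕ) :
    ∀ m l : ℕ, Fintype.card σ ≤ m + N → Fintype.card σ + l ≤ k + m →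
      ∑ a, c a * x a ^ l * (∏ b ∈ Finset.univ.erase a, (X - C (x b))).coeff m = 0 := by
  induction N with
  | zero =>
    intro m l hm _
    refine Finset.sum_eq_zero fun a _ => ?_
    rw [coeff_eq_zero_of_natDegree_lt, mul_zero]
    refine (natDegree_prod_le _ _).trans_lt ?_
    have h1 : ∑ b ∈ Finset.univ.erase a, (X - C (x b)).natDegree ≤
        ∑ b ∈ Finset.univ.erase a, 1 := Finset.sum_le_sum fun b _ => natDegree_X_sub_C_le _
    have h2 := Finset.card_erase_add_one (Finset.mem_univ a)
    rw [Finset.card_univ] at h2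
    rw [Finset.sum_const, smul_eq_mul, mul_one] at h1
    omega
  | succ N ih =>
    intro m l hm hl
    by_cases hmN : Fintype.card σ ≤ m + N
    · exact ih m l hmN hl
    have hrec : ∀ a, (∏ b ∈ Finset.univ.erase a, (X - C (x b))).coeff m =
        (∏ b, (X - C (x b))).coeff (m + 1) +
          x a * (∏ b ∈ Finset.univ.erase a, (X - C (x b))).coeff (m + 1) := by
      intro a
      rw [← Finset.mul_prod_erase Finset.univ _ (Finset.mem_univ a), sub_mul, coeff_sub,
        coeff_X_mul, coeff_C_mul]
      ring
    have h1 := ih (m + 1) (l + 1) (by omega) (by omega)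
    have h2 := hc l (by omega)
    calc ∑ a, c a * x a ^ l * (∏ b ∈ Finset.univ.erase a, (X - C (x b))).coeff m
        = (∑ a, c a * x a ^ l) * (∏ b, (X - C (x b))).coeff (m + 1) +
          ∑ a, c a * x a ^ (l + 1) *
            (∏ b ∈ Finset.univ.erase a, (X - C (x b))).coeff (m + 1) := by
          rw [Finset.sum_mul, ← Finset.sum_add_distrib]
          refine Finset.sum_congr rfl fun a _ => ?_
          rw [hrec a]; ring
      _ = 0 := by rw [h1, h2]; ring

/-- A vector with vanishing moments of order `< k` is, up to column multipliers, the vector of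
values of a polynomial of degree `< n - k`. -/
theorem degree_sum_prod_erase_lt {R σ : Type*} [CommRing R] [Fintype σ] [DecidableEq σ]
    (x c : σ → R) {k : ℕ} (hc : ∀ l < k, ∑ a, c a * x a ^ l = 0) :
    (∑ a, C (c a) * ∏ b ∈ Finset.univ.erase a, (X - C (x b))).degree <
      ((Fintype.card σ - k : ℕ) : WithBot ℕ) := by
  rw [degree_lt_iff_coeff_zero]
  intro m hm
  rw [finsetSum_coeff]
  have := sum_mul_pow_mul_coeff_eq_zero x c hc (Fintype.card σ) m 0 (by omega) (by omega)
  simpa using this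

variable {F : Type*} [Field F] {n t k : ℕ}

/-- A common set `W` of zeros misses the union of the supports, so `|W| ≤ n - |⋃ I_i|`, which turns
the weight bound into the Hall condition. The point `s` is merely split off as the root of
multiplicity at most one. -/
theorem zeroPatternCondition_of_wt_le (I : Fin t → Finset (Fin n))
    (hle : ∀ J : Finset (Fin t), J.Nonempty → wt I J ≤ ((J.card : ℤ) - 1) * (k : ℤ))
    (hkn : k ≤ n) (s : Fin n) :
    ZeroPatternCondition Finset.univ (fun i => (I i)ᶜ.erase s)
      (fun i => if s ∈ (I i)ᶜ then 1 else 0) (n - k) := by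
  have hcompl : ∀ J : Finset (Fin t), J.Nonempty → ∀ W : Finset (Fin n),
      (∀ i ∈ J, W ⊆ (I i)ᶜ) →
      ∑ i ∈ J, (((n - k : ℕ) : ℤ) - ((I i)ᶜ).card) + W.card ≤ ((n - k : ℕ) : ℤ) := by
    intro J hJ W hW
    have h1 := hle J hJ
    have h2 : Disjoint W (J.biUnion I) := by
      rw [Finset.disjoint_biUnion_right]
      exact fun i hi => Finset.disjoint_left.2 fun a ha => Finset.mem_compl.1 (hW i hi ha)
    have h3 : W.card + (J.biUnion I).card ≤ n := by
      rw [← Finset.card_union_of_disjoint h2]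
      exact (Finset.card_le_univ _).trans_eq (Fintype.card_fin n)
    have h4 : ∑ i ∈ J, (((n - k : ℕ) : ℤ) - ((I i)ᶜ).card) =
        ∑ i ∈ J, ((I i).card : ℤ) - J.card * k := by
      rw [← nsmul_eq_mul, ← Finset.sum_const, ← Finset.sum_sub_distrib]
      refine Finset.sum_congr rfl fun i _ => ?_
      have := Finset.card_add_card_compl (I i)
      rw [Fintype.card_fin] at this
      omega
    rw [wt] at h1
    rw [h4]
    push_cast [hkn]
    have h3' : (W.card : ℤ) + (J.biUnion I).card ≤ n := by exact_mod_cast h3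
    linarith
  intro J _ hJ W ρ hW hρ
  beta_reduce at hW hρ ⊢
  have h1 : ∑ i ∈ J, (((n - k : ℕ) : ℤ) - ((I i)ᶜ.erase s).card -
      ((if s ∈ (I i)ᶜ then 1 else 0 : ℕ) : ℤ)) =
      ∑ i ∈ J, (((n - k : ℕ) : ℤ) - ((I i)ᶜ).card) := by
    refine Finset.sum_congr rfl fun i _ => ?_
    split_ifs with hs
    · have := Finset.card_erase_add_one hs
      omega
    · rw [Finset.erase_eq_of_notMem hs]
      simp
  rw [h1]
  have hW' : ∀ i ∈ J, W ⊆ (I i)ᶜ := fun i hi => (hW i hi).trans (Finset.erase_subset _ _)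
  rcases Nat.eq_zero_or_pos ρ with rfl | hρpos
  · simpa using hcompl J hJ W hW'
  have hs : ∀ i ∈ J, s ∈ (I i)ᶜ := fun i hi => by
    by_contra hs
    have := hρ i hi
    rw [if_neg hs] at this
    omega
  have hsW : s ∉ W := fun h => by
    obtain ⟨i, hi⟩ := hJ
    exact Finset.notMem_erase s _ (hW i hi h)
  have h2 := hcompl J hJ (insert s W) fun i hi => Finset.insert_subset (hs i hi) (hW' i hi)
  rw [Finset.card_insert_of_notMem hsW] at h2
  have h3 : ρ ≤ 1 := by
    obtain ⟨i, hi⟩ := hJ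
    have := hρ i hi
    rwa [if_pos (hs i hi)] at this
  omega

/-- The subspaces of codewords supported on `I i` of the dual of the generic Reed-Solomon code of
dimension `k` are independent. -/
theorem eq_zero_of_supported_of_moments (I : Fin t → Finset (Fin n))
    (hle : ∀ J : Finset (Fin t), J.Nonempty → wt I J ≤ ((J.card : ℤ) - 1) * (k : ℤ))
    (c : Fin t → Fin n → MvPolynomial (Fin n) F) (hsupp : ∀ i, ∀ a ∉ I i, c i a = 0)
    (hmom : ∀ i, ∀ l < k, ∑ a, c i a * MvPolynomial.X a ^ l = 0)
    (hsum : ∀ a, ∑ i, c i a = 0) (i : Fin t) (s : Fin n) : c i s = 0 := by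
  set q : Fin n → (MvPolynomial (Fin n) F)[X] :=
    fun a => ∏ b ∈ Finset.univ.erase a, (X - C (MvPolynomial.X b)) with hq
  set g : Fin t → (MvPolynomial (Fin n) F)[X] := fun i => ∑ a, C (c i a) * q a with hg
  have hdeg : ∀ i, (g i).degree < ((n - k : ℕ) : WithBot ℕ) := fun i => by
    have := degree_sum_prod_erase_lt MvPolynomial.X (c i) (hmom i)
    rwa [Fintype.card_fin] at this
  have hgsum : ∑ i, g i = 0 := by
    rw [hg, Finset.sum_comm]
    refine Finset.sum_eq_zero fun a _ => ?_
    rw [← Finset.sum_mul, ← map_sum, hsum, map_zero, zero_mul]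
  have hdvd : ∀ i, rootPoly F s ((I i)ᶜ.erase s) (if s ∈ (I i)ᶜ then 1 else 0) ∣ g i := by
    intro i
    have h1 : rootPoly F s ((I i)ᶜ.erase s) (if s ∈ (I i)ᶜ then 1 else 0) =
        ∏ a ∈ (I i)ᶜ, (X - C (MvPolynomial.X a)) := by
      split_ifs with hs
      · rw [rootPoly, pow_one, Finset.mul_prod_erase _ (fun a => X - C (MvPolynomial.X a)) hs]
      · rw [rootPoly, pow_zero, one_mul, Finset.erase_eq_of_notMem hs]
    rw [h1]
    refine Finset.dvd_sum fun a _ => ?_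
    by_cases ha : a ∈ I i
    · refine Dvd.dvd.mul_left (Finset.prod_dvd_prod_of_subset _ _ _ fun b hb => ?_) _
      exact Finset.mem_erase.2 ⟨fun h => Finset.mem_compl.1 hb (h ▸ ha), Finset.mem_univ b⟩
    · simp [hsupp i a ha]
  have hg0 : g i = 0 := by
    -- For `n < k` the truncated bound `n - k = 0` already gives `g i = 0`.
    rcases lt_or_ge n k with hnk | hkn
    · have := hdeg i
      rw [Nat.sub_eq_zero_of_le hnk.le] at this
      exact degree_eq_bot.1 (by simpa using this)
    choose h hh using hdvd
    have := zeroPatternIndependent_of_condition F s _ Finset.univ (Finset.univ.erase s) _ _ _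
      le_rfl (fun i _ => Finset.erase_subset_erase s (Finset.subset_univ _))
      (Finset.notMem_erase s _) (zeroPatternCondition_of_wt_le I hle hkn s) h
      (fun i _ => by rw [← hh]; exact hdeg i) (by simpa only [← hh] using hgsum) i
      (Finset.mem_univ i)
    rw [hh, this, mul_zero]
  -- As in Lagrange interpolation, only the summand of `s` survives at `x_s`.
  have hev := congrArg (eval (MvPolynomial.X s)) hg0
  rw [hg, eval_finsetSum, Finset.sum_eq_single s, eval_mul, eval_C, eval_zero] at hev
  · refine (mul_eq_zero.1 hev).resolve_right ?_
    rw [hq, eval_prod]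
    refine Finset.prod_ne_zero_iff.2 fun b hb => ?_
    rw [eval_sub, eval_X, eval_C, sub_ne_zero]
    exact fun h => Finset.ne_of_mem_erase hb (MvPolynomial.X_injective h).symm
  · intro a _ has
    rw [eval_mul, hq, eval_prod,
      Finset.prod_eq_zero (Finset.mem_erase.2 ⟨has.symm, Finset.mem_univ s⟩) (by simp), mul_zero]
  · simp

end DualCode

/-! ### Star rows, triangles and the left kernel. -/

section IntersectionMatrix

variable {n t : ℕ}

/-- The rows of the blocks `V_k(I_i ∩ I_j)`, `i < j`, that belong to an element `a` of which `I_j`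
is the last set containing it. -/
def IsStarRow (I : Fin t → Finset (Fin n))
    (x : Σ e : Edge t, (I e.1.1 ∩ I e.1.2 : Finset (Fin n))) : Prop :=
  ∀ j, (x.2 : Fin n) ∈ I j → j ≤ x.1.1.2

/-- Incidences `a ∈ I_j` split according to whether `j` is the last index for `a`: the last ones
correspond to elements of the union, the others to star rows `{j, m}`. -/
theorem card_isStarRow_add_card (I : Fin t → Finset (Fin n)) :
    Nat.card {x // IsStarRow I x} + (Finset.univ.biUnion I).card = ∑ j, (I j).card := by
  classical
  have hmax : ∀ a : Finset.univ.biUnion I, ∃ m : Fin t, (a : Fin n) ∈ I m ∧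
      ∀ j, (a : Fin n) ∈ I j → j ≤ m := by
    rintro ⟨a, ha⟩
    have hne : (Finset.univ.filter fun j => a ∈ I j).Nonempty := by
      obtain ⟨j, -, hj⟩ := Finset.mem_biUnion.1 ha
      exact ⟨j, by simpa using hj⟩
    exact ⟨_, (Finset.mem_filter.1 (Finset.max'_mem _ hne)).2, fun j hj =>
      Finset.le_max' _ _ (by simpa using hj)⟩
  choose m hm hmle using hmax
  let f : {x // IsStarRow I x} ⊕ (Finset.univ.biUnion I) → Σ j, I j := Sum.elim
    (fun x => ⟨x.1.1.1.1, x.1.2, (Finset.mem_inter.1 x.1.2.2).1⟩) (fun a => ⟨m a, a, hm a⟩)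
  have hf : Function.Bijective f := by
    constructor
    · have hlr : ∀ (x : {x // IsStarRow I x}) (a : Finset.univ.biUnion I),
          f (Sum.inl x) ≠ f (Sum.inr a) := by
        rintro ⟨⟨⟨⟨i, j⟩, hij⟩, ⟨b, hb⟩⟩, hx⟩ ⟨a, ha⟩ h
        have h1 := congrArg (fun p => p.1) h
        have h2 := congrArg (fun p => (p.2 : Fin n)) h
        change i = m ⟨a, ha⟩ at h1
        change b = a at h2
        subst h2
        have h3 := hmle ⟨b, ha⟩ j (Finset.mem_inter.1 hb).2
        exact absurd (lt_of_lt_of_le hij h3) (by rw [h1]; exact lt_irrefl _)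
      rintro (x | a) (y | b) h
      · obtain ⟨⟨⟨⟨i, j⟩, hij⟩, ⟨b, hb⟩⟩, hx⟩ := x
        obtain ⟨⟨⟨⟨i', j'⟩, hij'⟩, ⟨b', hb'⟩⟩, hy⟩ := y
        have h1 := congrArg (fun p => p.1) h
        have h2 := congrArg (fun p => (p.2 : Fin n)) h
        change i = i' at h1
        change b = b' at h2
        subst h1 h2
        obtain rfl : j = j' :=
          le_antisymm (hy j (Finset.mem_inter.1 hb).2) (hx j' (Finset.mem_inter.1 hb').2)
        rfl
      · exact absurd h (hlr x b)
      · exact absurd h.symm (hlr y a)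
      · have h2 := congrArg (fun p => (p.2 : Fin n)) h
        exact congrArg Sum.inr (Subtype.ext h2)
    · rintro ⟨i, a, ha⟩
      have hau : a ∈ Finset.univ.biUnion I := Finset.mem_biUnion.2 ⟨i, Finset.mem_univ i, ha⟩
      rcases (hmle ⟨a, hau⟩ i ha).lt_or_eq with hlt | heq
      · exact ⟨Sum.inl ⟨⟨⟨(i, m ⟨a, hau⟩), hlt⟩, ⟨a, Finset.mem_inter.2 ⟨ha, hm ⟨a, hau⟩⟩⟩⟩,
          hmle ⟨a, hau⟩⟩, rfl⟩
      · subst heq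
        exact ⟨Sum.inr ⟨a, hau⟩, rfl⟩
  have h := Nat.card_eq_of_bijective f hf
  rw [Nat.card_sum, Nat.card_eq_finsetCard, Nat.card_sigma] at h
  simpa only [Nat.card_eq_finsetCard] using h

/-- A triangle has degree 0 or 2 at each vertex. -/
theorem sum_triangleMatrix_incident (R : Type*) [CommRing R] [CharP R 2] (d : Edge 3)
    (i : Fin 4) :
    ∑ e : Edge 4 with i = e.1.1 ∨ i = e.1.2, triangleMatrix 3 R d e = 0 := by
  have h : ∀ (d : Edge 3) (i : Fin 4), 2 ∣ ((Finset.univ.filter fun e : Edge 4 =>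
      (i = e.1.1 ∨ i = e.1.2) ∧
      (e.1.1 ∈ ({d.1.1.castSucc, d.1.2.castSucc, Fin.last 3} : Finset (Fin 4)) ∧
        e.1.2 ∈ ({d.1.1.castSucc, d.1.2.castSucc, Fin.last 3} : Finset (Fin 4)))).card) := by
    decide
  simp only [triangleMatrix, Matrix.of_apply]
  rw [Finset.sum_boole, Finset.filter_filter]
  exact (CharP.cast_eq_zero_iff R 2 _).2 (h d i)

/-- An edge avoiding the last vertex lies in only one basis triangle, so these columns form an
identity matrix and show that the triangle rows are independent. -/
theorem triangleMatrix_castSucc (R : Type*) [Zero R] [One R] (d d' : Edge 3) :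
    triangleMatrix 3 R d ⟨(d'.1.1.castSucc, d'.1.2.castSucc), d'.2⟩ = if d = d' then 1 else 0 := by
  have h : ∀ d d' : Edge 3,
      (d'.1.1.castSucc ∈ ({d.1.1.castSucc, d.1.2.castSucc, Fin.last 3} : Finset (Fin 4)) ∧
        d'.1.2.castSucc ∈ ({d.1.1.castSucc, d.1.2.castSucc, Fin.last 3} : Finset (Fin 4))) ↔
      d = d' := by
    decide
  simp only [triangleMatrix, Matrix.of_apply]
  exact if_congr (h d d') rfl rfl

variable {F : Type*} [Field F] {m k : ℕ}

/-- The part of a row vector belonging to the Vandermonde blocks, extended by zero. -/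
noncomputable def blockPart {I : Fin (m + 1) → Finset (Fin n)}
    (v : IntersectionRow k I → MvPolynomial (Fin n) F) (e : Edge (m + 1)) (a : Fin n) :
    MvPolynomial (Fin n) F :=
  if h : a ∈ I e.1.1 ∩ I e.1.2 then v (Sum.inr ⟨e, a, h⟩) else 0

theorem vecMul_intersectionMatrix_apply (I : Fin (m + 1) → Finset (Fin n))
    (v : IntersectionRow k I → MvPolynomial (Fin n) F) (e : Edge (m + 1)) (l : Fin k) :
    Matrix.vecMul v (intersectionMatrix F k I) (e, l) =
      ∑ d, v (Sum.inl (d, l)) * triangleMatrix m (MvPolynomial (Fin n) F) d e +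
        ∑ a, blockPart v e a * MvPolynomial.X a ^ (l : ℕ) := by
  simp only [Matrix.vecMul, dotProduct, Fintype.sum_sum_type, intersectionMatrix,
    Matrix.fromRows_apply_inl, Matrix.fromRows_apply_inr]
  congr 1
  · rw [Fintype.sum_prod_type]
    refine Finset.sum_congr rfl fun d _ => ?_
    rw [Finset.sum_eq_single l]
    · simp [Matrix.kroneckerMap_apply]
    · intro l' _ hl
      simp [Matrix.kroneckerMap_apply, Matrix.one_apply_ne hl]
    · simp
  · rw [Fintype.sum_sigma, Finset.sum_eq_single e]
    · rw [← Finset.sum_subset (s₁ := I e.1.1 ∩ I e.1.2)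
        (f := fun a => blockPart v e a * MvPolynomial.X a ^ (l : ℕ)) (Finset.subset_univ _),
        ← Finset.sum_coe_sort (I e.1.1 ∩ I e.1.2)]
      · refine Finset.sum_congr rfl fun a _ => ?_
        rw [blockPart, dif_pos a.2]
        simp [vandermondeDiag, variableVandermonde]
      · intro a _ ha
        rw [blockPart, dif_neg ha, zero_mul]
    · intro e' _ he
      simp [vandermondeDiag, he]
    · simp

theorem eq_zero_of_vecMul_intersectionMatrix [CharP F 2] (I : Fin 4 → Finset (Fin n))
    (hle : ∀ J : Finset (Fin 4), J.Nonempty → wt I J ≤ ((J.card : ℤ) - 1) * (k : ℤ))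
    (v : IntersectionRow (m := 3) k I → MvPolynomial (Fin n) F)
    (hstar : ∀ x, ¬ IsStarRow I x → v (Sum.inr x) = 0)
    (hv : Matrix.vecMul v (intersectionMatrix (m := 3) F k I) = 0) : v = 0 := by
  have hcol : ∀ e l, ∑ d, v (Sum.inl (d, l)) * triangleMatrix 3 (MvPolynomial (Fin n) F) d e +
      ∑ a, blockPart v e a * MvPolynomial.X a ^ (l : ℕ) = 0 := fun e l => by
    rw [← vecMul_intersectionMatrix_apply, hv, Pi.zero_apply]
  have hC := eq_zero_of_supported_of_moments I hle
    (fun i a => ∑ e : Edge 4 with i = e.1.1 ∨ i = e.1.2, blockPart v e a) ?_ ?_ ?_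
  · have hblock : ∀ e a, blockPart v e a = 0 := by
      intro e a
      by_cases ha : a ∈ I e.1.1 ∩ I e.1.2
      swap
      · rw [blockPart, dif_neg ha]
      by_cases hs : IsStarRow I ⟨e, a, ha⟩
      swap
      · rw [blockPart, dif_pos ha, hstar _ hs]
      rw [← hC e.1.1 a, eq_comm]
      -- The lower end of `e` is a leaf of the star of `a`, so no other star edge of `a` meets it.
      refine Finset.sum_eq_single_of_mem e (by simp) fun e' he' hne => ?_
      by_cases ha' : a ∈ I e'.1.1 ∩ I e'.1.2
      swap
      · rw [blockPart, dif_neg ha']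
      rw [blockPart, dif_pos ha']
      refine hstar _ fun hs' => hne ?_
      have h2 : e'.1.2 = e.1.2 :=
        le_antisymm (hs _ (Finset.mem_inter.1 ha').2) (hs' _ (Finset.mem_inter.1 ha).2)
      have h1 : e.1.1 = e'.1.1 := by
        refine (Finset.mem_filter.1 he').2.resolve_right fun h => ?_
        exact absurd e.2 (by rw [h, h2]; exact lt_irrefl _)
      exact Subtype.ext (Prod.ext h1.symm h2)
    funext x
    rcases x with ⟨d, l⟩ | ⟨e, a, ha⟩
    · have h := hcol ⟨(d.1.1.castSucc, d.1.2.castSucc), d.2⟩ l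
      simpa [triangleMatrix_castSucc, hblock] using h
    · have h := hblock e a
      rwa [blockPart, dif_pos ha] at h
  · intro i a ha
    refine Finset.sum_eq_zero fun e he => ?_
    rw [blockPart, dif_neg]
    intro h
    rw [Finset.mem_inter] at h
    rcases (Finset.mem_filter.1 he).2 with rfl | rfl
    · exact ha h.1
    · exact ha h.2
  · intro i l hl
    have h := Finset.sum_eq_zero (s := Finset.univ.filter
      fun e : Edge 4 => i = e.1.1 ∨ i = e.1.2) fun e _ => hcol e ⟨l, hl⟩
    rw [Finset.sum_add_distrib, Finset.sum_comm] at h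
    simp only [← Finset.mul_sum, sum_triangleMatrix_incident, mul_zero, Finset.sum_const_zero,
      zero_add] at h
    rw [Finset.sum_comm] at h
    simpa only [Finset.sum_mul] using h
  · intro a
    simp only [Finset.sum_filter]
    rw [Finset.sum_comm]
    refine Finset.sum_eq_zero fun e _ => ?_
    have hcard : ∀ e : Edge 4,
        (Finset.univ.filter fun i : Fin 4 => i = e.1.1 ∨ i = e.1.2).card = 2 := by decide
    rw [← Finset.sum_filter, Finset.sum_const, hcard, two_nsmul, CharTwo.add_self_eq_zero]

end IntersectionMatrix

/-- Nonsingularity of `4`-wise intersection matrices over a finite field of characteristic two. -/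
theorem theorem7 {F : Type*} [Field F] [Finite F] [CharP F 2] {n k : ℕ} (hk : 0 < k)
    (I : Fin 4 → Finset (Fin n))
    (hle : ∀ J : Finset (Fin 4), J.Nonempty → wt I J ≤ ((J.card : ℤ) - 1) * (k : ℤ))
    (heq : wt I Finset.univ = 3 * (k : ℤ)) :
    ∃ (r : Fin (6 * k) ↪ IntersectionRow (m := 3) k I) (c : Fin (6 * k) ↪ Edge 4 × Fin k),
      ((intersectionMatrix (m := 3) F k I).submatrix r c).det ≠ 0 := by
  classical
  have hcol : Nat.card (Edge 4 × Fin k) = 6 * k := by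
    rw [Nat.card_prod, Nat.card_eq_fintype_card, Nat.card_eq_fintype_card, Fintype.card_fin]
    congr 1
  have hrow : Nat.card ((Edge 3 × Fin k) ⊕ {x // IsStarRow I x}) = 6 * k := by
    have h1 : Nat.card (Edge 3 × Fin k) = 3 * k := by
      rw [Nat.card_prod, Nat.card_eq_fintype_card, Nat.card_eq_fintype_card, Fintype.card_fin]
      congr 1
    have h2 := card_isStarRow_add_card I
    rw [wt] at heq
    rw [Nat.card_sum, h1]
    zify at h2 ⊢
    linarith
  let c : Fin (6 * k) ≃ Edge 4 × Fin k := (Finite.equivFinOfCardEq hcol).symm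
  let e : Fin (6 * k) ≃ (Edge 3 × Fin k) ⊕ {x // IsStarRow I x} :=
    (Finite.equivFinOfCardEq hrow).symm
  let r : Fin (6 * k) ↪ IntersectionRow (m := 3) k I :=
    e.toEmbedding.trans ((Function.Embedding.refl _).sumMap (Function.Embedding.subtype _))
  refine ⟨r, c.toEmbedding, fun hdet => ?_⟩
  obtain ⟨w, hw0, hw⟩ := Matrix.exists_vecMul_eq_zero_iff.2 hdet
  -- Extended by zero to the unselected rows, `w` lies in the left kernel of the whole matrix.
  have hv : Function.extend r w 0 = 0 := by
    refine eq_zero_of_vecMul_intersectionMatrix I hle _ (fun x hx => ?_) (funext fun p => ?_)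
    · rw [Function.extend_apply', Pi.zero_apply]
      rintro ⟨i, hi⟩
      change Sum.map id Subtype.val (e i) = _ at hi
      rcases he : e i with d | y
      · rw [he] at hi
        simp at hi
      · rw [he] at hi
        exact hx (Sum.inr_injective hi ▸ y.2)
    · have h := congrFun hw (c.symm p)
      rw [Pi.zero_apply] at h ⊢
      rw [← h]
      simp only [Matrix.vecMul, dotProduct, Matrix.submatrix_apply]
      refine (Fintype.sum_of_injective r r.injective _ _ (fun x hx => ?_) fun i => ?_).symm
      · rw [Function.extend_apply' _ _ _ hx, Pi.zero_apply, zero_mul]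
      · rw [r.injective.extend_apply, Equiv.coe_toEmbedding, Equiv.apply_symm_apply]
  refine hw0 (funext fun i => ?_)
  rw [← r.injective.extend_apply w 0 i, hv]
  rfl
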